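/- Let $0<a<1$ and let $f$ be a continuous map from $[0,1]$ onto itself such that $f(0)=0=f(1)$, $f(a)=1$, and $f$ is strictly increasing on $[0,a]$ and strictly decreasing on $[a,1]$. Write $f^n$ for the $n$-th iterate of $f$. Then the following statements are equivalent: (a) $f$ has a dense orbit, i.e. for some $x\in[0,1]$ the set $\{f^k(x) : k\ge 0\}$ is dense in $[0,1]$; (b) the periodic points of $f$ are dense in $[0,1]$; (c) $f$ has sensitive dependence on initial conditions, i.e. there exists $\delta>0$ such that for every $x\in[0,1]$ and every open neighborhood $V$ of $x$ in $[0,1]$ there exist $y\in V$ and an integer $n\ge 1$ with $|f^n(x)-f^n(y)|\ge\delta$. Furthermore, if $f$ has a dense orbit, then $f$ is topologically conjugate to the tent map $T(x)=1-|2x-1|$ on $[0,1]$, and there is a dense uncountable set $S\subseteq[0,1]$ with $f(S)\subseteq S$, consisting of transitive points (points whose orbit under $f$ is dense in $[0,1]$), which is a $1$-scrambled set of $f$. Here, for $\delta>0$, a set $S$ is called $\delta$-scrambled for $f$ if (i) for all $x\ne y$ in $S$, $\limsup_{n\to\infty}|f^n(x)-f^n(y)|\ge\delta$ and $\liminf_{n\to\infty}|f^n(x)-f^n(y)|=0$;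 and (ii) for every $x$ in $S$ and every periodic point $p$ of $f$, $\limsup_{n\to\infty}|f^n(x)-f^n(p)|\ge\delta/2$. -/

import Mathlib

open Filter

noncomputable section

/-- The forward orbit `{f^k(x) | k ≥ 0}` of `x` under `f`. -/
def orbitOf {X : Type*} (f : X → X) (x : X) : Set X :=
  Set.range fun k : ℕ => f^[k] x

/-- A transitive point: a point whose orbit is dense. -/
def IsTransitivePoint {X : Type*} [TopologicalSpace X] (f : X → X) (x : X) : Prop :=
  Dense (orbitOf f x)

/-- Sensitive dependence on initial conditions for a self-map of `[0, 1]`. -/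
def SensitiveDependence (f : unitInterval → unitInterval) : Prop :=
  ∃ δ : ℝ, 0 < δ ∧ ∀ x : unitInterval, ∀ V : Set unitInterval, IsOpen V → x ∈ V →
    ∃ y ∈ V, ∃ n : ℕ, 0 < n ∧ δ ≤ |((f^[n] x : unitInterval) : ℝ) - (f^[n] y : unitInterval)|

/-- `S` is a `δ`-scrambled set of `f`: the two conditions on distinct pairs of points of `S`, and
the condition on pairs made of a point of `S` and a periodic point of `f`. All the sequences
involved take values in `[0, 1]`, so that the upper and lower limits are the usual ones.
Uncountability of `S` is not part of this definition. -/
structure IsScrambledSet (f : unitInterval → unitInterval) (δ : ℝ) (S : Set unitInterval) :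
    Prop where
  delta_pos : 0 < δ
  limsup_pair : ∀ x ∈ S, ∀ y ∈ S, x ≠ y →
    δ ≤ limsup (fun n : ℕ => |((f^[n] x : unitInterval) : ℝ) - (f^[n] y : unitInterval)|) atTop
  liminf_pair : ∀ x ∈ S, ∀ y ∈ S, x ≠ y →
    liminf (fun n : ℕ => |((f^[n] x : unitInterval) : ℝ) - (f^[n] y : unitInterval)|) atTop = 0
  limsup_periodic : ∀ x ∈ S, ∀ p ∈ Function.periodicPts f,
    δ / 2 ≤ limsup (fun n : ℕ => |((f^[n] x : unitInterval) : ℝ) - (f^[n] p : unitInterval)|) atTop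

/-- Topological conjugacy of two self-maps. -/
def TopologicallyConjugate {X Y : Type*} [TopologicalSpace X] [TopologicalSpace Y]
    (f : X → X) (g : Y → Y) : Prop :=
  ∃ h : X ≃ₜ Y, ∀ x, h (f x) = g (h x)

/-- The tent map `T(x) = 1 - |2x - 1|` on `[0, 1]`. -/
def tentMap (x : unitInterval) : unitInterval :=
  ⟨1 - |2 * (x : ℝ) - 1|, by
    have h0 := x.2.1
    have h1 := x.2.2
    constructor
    · have : |2 * (x : ℝ) - 1| ≤ 1 := abs_le.mpr ⟨by linarith, by linarith⟩
      linarith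
    · have := abs_nonneg (2 * (x : ℝ) - 1)
      linarith⟩

end

/-! Contraction gives a monotone continuous surjection `h` with `h ∘ f = tentMap ∘ h`. Its fibres
are intervals, and each of the three properties forces them to be points, so that `h` becomes a
conjugacy. Suppose the fibre over `t` is nondegenerate.

A dense orbit enters its interior twice, so its image under `h` is a finite tent orbit, yet that
image is dense. If periodic points are dense, every nondegenerate fibre lies over a periodic point;
the reflected fibre over `1 - t` is nondegenerate too, but `t` and `1 - t` have the same tent image
and cannot both be periodic unless `t = 1/2`, which is not periodic. If `f` is sensitive, no point
of equicontinuity exists; but one does: for `t` with infinite orbit the images of the fibre lie in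
disjoint intervals and shrink, and otherwise some nondegenerate fibre is preserved by an increasing
iterate of `f`.

Conversely, the tent map is locally eventually onto, and this passes through the conjugacy. It
yields sensitivity, dense periodic points and, by Baire category, transitive points and the
scrambled set: for a generic `x`, generic `y` make the orbit of `(x, y)` dense in the square. -/

section

open Set Topology unitInterval Function

/-! ### Baire category and cluster points -/

section General

/-- Every neighbourhood is mapped onto the whole space by all large iterates. -/
def LocallyEventuallyOnto {X : Type*} [TopologicalSpace X] (f : X → X) : Prop :=
  ∀ x, ∀ W ∈ 𝓝 x, ∀ᶠ n in atTop, f^[n] '' W = univ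

/-- Birkhoff's criterion: if the maps `g n` frequently send some point of any nonempty open set into
any other nonempty open set, then generic points have every point as a cluster point. -/
theorem residual_forall_mapClusterPt {X Y : Type*} [TopologicalSpace X] [TopologicalSpace Y]
    [SecondCountableTopology Y] {g : ℕ → X → Y} (hg : ∀ n, Continuous (g n))
    (H : ∀ W : Set X, IsOpen W → W.Nonempty → ∀ V : Set Y, IsOpen V → V.Nonempty →
      ∃ᶠ n in atTop, ∃ w ∈ W, g n w ∈ V) :
    ∀ᶠ w in residual X, ∀ v, MapClusterPt v atTop fun n => g n w := by
  have key : ∀ᶠ w in residual X, ∀ V ∈ TopologicalSpace.countableBasis Y, ∀ N : ℕ,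
      ∃ n ≥ N, g n w ∈ V := by
    rw [eventually_countable_ball (TopologicalSpace.countable_countableBasis Y)]
    intro V hV
    rw [eventually_countable_forall]
    intro N
    have hVo := TopologicalSpace.isOpen_of_mem_countableBasis hV
    have hVn := TopologicalSpace.nonempty_of_mem_countableBasis hV
    have hset : {w | ∃ n ≥ N, g n w ∈ V} = ⋃ n ≥ N, g n ⁻¹' V := by
      ext w; simp
    refine residual_of_dense_open (s := {w | ∃ n ≥ N, g n w ∈ V}) ?_ ?_
    · rw [hset]
      exact isOpen_biUnion fun n _ => hVo.preimage (hg n)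
    · rw [dense_iff_inter_open]
      intro W hW hWn
      obtain ⟨n, hn, w, hw, hgw⟩ := frequently_atTop.1 (H W hW hWn V hVo hVn) N
      exact ⟨w, hw, n, hn, hgw⟩
  filter_upwards [key] with w hw v
  rw [mapClusterPt_iff_frequently]
  intro s hs
  obtain ⟨V, hV, hvV, hVs⟩ :=
    (TopologicalSpace.isBasis_countableBasis Y).mem_nhds_iff.1 hs
  rw [frequently_atTop]
  intro N
  obtain ⟨n, hn, hgn⟩ := hw V hV N
  exact ⟨n, hn, hVs hgn⟩

theorem le_limsup_of_mapClusterPt {u : ℕ → ℝ} {c : ℝ} (hb : ∃ B, ∀ n, u n ≤ B)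
    (h : MapClusterPt c atTop u) : c ≤ limsup u atTop := by
  obtain ⟨B, hB⟩ := hb
  refine le_of_forall_lt fun b hbc => ?_
  obtain ⟨d, hbd, hdc⟩ := exists_between hbc
  refine hbd.trans_le (le_limsup_of_frequently_le ?_ (isBoundedUnder_of ⟨B, hB⟩))
  exact (mapClusterPt_iff_frequently.1 h _ (Ioi_mem_nhds hdc)).mono fun n hn => le_of_lt hn

theorem liminf_eq_zero_of_mapClusterPt {u : ℕ → ℝ} (h0 : ∀ n, 0 ≤ u n) (hb : ∃ B, ∀ n, u n ≤ B)
    (h : MapClusterPt 0 atTop u) : liminf u atTop = 0 := by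
  obtain ⟨B, hB⟩ := hb
  refine le_antisymm ?_ ?_
  · refine le_of_forall_gt fun b hbc => ?_
    obtain ⟨d, hbd, hdc⟩ := exists_between hbc
    refine (liminf_le_of_frequently_le ?_ (isBoundedUnder_of ⟨0, h0⟩)).trans_lt hdc
    exact (mapClusterPt_iff_frequently.1 h _ (Iio_mem_nhds hbd)).mono fun n hn => le_of_lt hn
  · exact le_liminf_of_le (isBoundedUnder_of ⟨B, hB⟩).isCoboundedUnder_ge (Eventually.of_forall h0)

/-- An uncountable set on which a symmetric relation holds pairwise, by Zorn's lemma. -/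
theorem exists_uncountable_pairwise {X : Type*} [TopologicalSpace X] [BaireSpace X] [Nonempty X]
    [T1Space X] [∀ x : X, NeBot (𝓝[≠] x)] {A : Set X} (hA : A ∈ residual X)
    {R : X → X → Prop} (hsymm : ∀ x y, R x y → R y x)
    (hR : ∀ x ∈ A, ∀ᶠ y in residual X, R x y) :
    ∃ S ⊆ A, ¬ S.Countable ∧ S.Pairwise R := by
  obtain ⟨S, hS⟩ := zorn_subset {S : Set X | S ⊆ A ∧ S.Pairwise R} (by
    intro c hc hchain
    refine ⟨⋃₀ c, ⟨sUnion_subset fun s hs => (hc hs).1, ?_⟩, fun s hs => subset_sUnion_of_mem hs⟩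
    exact (pairwise_sUnion hchain.directedOn).2 fun s hs => (hc hs).2)
  refine ⟨S, hS.prop.1, fun hcount => ?_, hS.prop.2⟩
  have h1 : ∀ᶠ y in residual X, ∀ x ∈ S, R x y :=
    (eventually_countable_ball hcount).2 fun x hx => hR x (hS.prop.1 hx)
  have h2 : ∀ᶠ y in residual X, ∀ x ∈ S, y ≠ x :=
    (eventually_countable_ball hcount).2 fun x _ =>
      residual_of_dense_open isOpen_compl_singleton (dense_compl_singleton x)
  have h3 : ∀ᶠ y in residual X, y ∈ A := hA
  obtain ⟨y, hy1, hy2, hyA⟩ := (dense_of_mem_residual (h1.and (h2.and h3))).nonempty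
  -- Were the maximal `S` countable, a generic `y` would be new and related to all of `S`.
  have hins : insert y S ∈ {S : Set X | S ⊆ A ∧ S.Pairwise R} := by
    refine ⟨insert_subset hyA hS.prop.1, hS.prop.2.insert fun x hx _ => ⟨?_, hy1 x hx⟩⟩
    exact hsymm _ _ (hy1 x hx)
  exact hy2 y (hS.le_of_ge hins (subset_insert y S) (mem_insert y S)) rfl

theorem LocallyEventuallyOnto.eventually_exists {X : Type*} [TopologicalSpace X] {f : X → X}
    (hf : LocallyEventuallyOnto f) {W : Set X} (hW : IsOpen W) (hWn : W.Nonempty) (z : X → Prop)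
    (hz : ∃ v, z v) : ∀ᶠ n in atTop, ∃ w ∈ W, z (f^[n] w) := by
  obtain ⟨x, hx⟩ := hWn
  obtain ⟨v, hv⟩ := hz
  filter_upwards [hf x W (hW.mem_nhds hx)] with n hn
  obtain ⟨w, hw, rfl⟩ : v ∈ f^[n] '' W := hn ▸ mem_univ v
  exact ⟨w, hw, hv⟩

end General

/-! ### Consequences of being locally eventually onto; the scrambled set -/

section Interval

variable {f : unitInterval → unitInterval}

theorem LocallyEventuallyOnto.sensitiveDependence (hf : LocallyEventuallyOnto f) :
    SensitiveDependence f := by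
  refine ⟨1 / 2, by norm_num, fun x V hV hx => ?_⟩
  obtain ⟨n, hn, hn0⟩ := ((hf x V (hV.mem_nhds hx)).and (eventually_gt_atTop 0)).exists
  obtain ⟨y, hy, hy0⟩ : (0 : unitInterval) ∈ f^[n] '' V := hn ▸ mem_univ _
  obtain ⟨z, hz, hz1⟩ : (1 : unitInterval) ∈ f^[n] '' V := hn ▸ mem_univ _
  rcases le_total (1 / 2 : ℝ) (f^[n] x) with h | h
  · refine ⟨y, hy, n, hn0, ?_⟩
    rw [hy0]
    simpa using h.trans (le_abs_self _)
  · refine ⟨z, hz, n, hn0, ?_⟩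
    rw [hz1, abs_sub_comm]
    refine le_trans ?_ (le_abs_self _)
    push_cast
    linarith

/-- Some iterate maps a small interval onto `[0, 1]`, so its graph over that interval meets the
diagonal. -/
theorem LocallyEventuallyOnto.dense_periodicPts (hf : LocallyEventuallyOnto f)
    (hc : Continuous f) : Dense (periodicPts f) := by
  rw [dense_iff_inter_open]
  rintro W hW ⟨x, hx⟩
  obtain ⟨b, c, -, hbc, hsub⟩ := exists_Icc_mem_subset_of_mem_nhds (hW.mem_nhds hx)
  obtain ⟨n, hn, hn0⟩ := ((hf x _ hbc).and (eventually_gt_atTop 0)).exists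
  obtain ⟨y, hy, hy0⟩ : (0 : unitInterval) ∈ f^[n] '' Icc b c := hn ▸ mem_univ _
  obtain ⟨z, hz, hz1⟩ : (1 : unitInterval) ∈ f^[n] '' Icc b c := hn ▸ mem_univ _
  obtain ⟨p, hp, hfp⟩ := isPreconnected_Icc.intermediate_value₂ hy hz
    (hc.iterate n).continuousOn continuousOn_id (by rw [hy0]; exact nonneg')
    (by rw [hz1]; exact le_one')
  exact ⟨p, hsub hp, n, hn0, hfp⟩

/-- The pairs whose orbits simultaneously approach any pair of points. -/
def JointlyTransitive (f : unitInterval → unitInterval) (x y : unitInterval) : Prop :=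
  ∀ v : unitInterval × unitInterval, MapClusterPt v atTop fun n => (f^[n] x, f^[n] y)

/-- The points which are transitive for all powers of the map. -/
def totallyTransitivePts (f : unitInterval → unitInterval) : Set unitInterval :=
  {x | ∀ m : ℕ, 0 < m → ∀ u, MapClusterPt u atTop fun n => f^[m * n] x}

theorem JointlyTransitive.symm {x y : unitInterval} (h : JointlyTransitive f x y) :
    JointlyTransitive f y x := fun v =>
  (h v.swap).continuousAt_comp (f := Prod.swap) continuous_swap.continuousAt

theorem mapClusterPt_of_mem_totallyTransitivePts {x : unitInterval}
    (hx : x ∈ totallyTransitivePts f) (u : unitInterval) :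
    MapClusterPt u atTop fun n => f^[n] x := by
  simpa using hx 1 one_pos u

theorem LocallyEventuallyOnto.totallyTransitivePts_mem_residual (hf : LocallyEventuallyOnto f)
    (hc : Continuous f) : totallyTransitivePts f ∈ residual unitInterval := by
  have : ∀ᶠ x in residual unitInterval, ∀ m : ℕ, 0 < m → ∀ u,
      MapClusterPt u atTop fun n => f^[m * n] x := by
    rw [eventually_countable_forall]
    intro m
    by_cases hm : 0 < m
    · simp only [hm, forall_const]
      refine residual_forall_mapClusterPt (fun n => hc.iterate _) fun W hW hWn V _ hVn => ?_
      have htend : Tendsto (fun n => m * n) atTop atTop := tendsto_id.const_mul_atTop' hm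
      exact (htend.eventually (hf.eventually_exists hW hWn (· ∈ V) hVn)).frequently
    · simp [hm]
  exact this

theorem LocallyEventuallyOnto.residual_jointlyTransitive (hf : LocallyEventuallyOnto f)
    (hc : Continuous f) {x : unitInterval} (hx : x ∈ totallyTransitivePts f) :
    ∀ᶠ y in residual unitInterval, JointlyTransitive f x y := by
  refine residual_forall_mapClusterPt
    (fun n => continuous_const.prodMk (hc.iterate n)) fun W hW hWn V hV hVn => ?_
  obtain ⟨⟨u, v⟩, huv⟩ := hVn
  obtain ⟨U₁, hU₁, U₂, hU₂, hsub⟩ := mem_nhds_prod_iff.1 (hV.mem_nhds huv)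
  have h1 := mapClusterPt_iff_frequently.1 (mapClusterPt_of_mem_totallyTransitivePts hx u) U₁ hU₁
  have h2 := hf.eventually_exists hW hWn (· ∈ U₂) ⟨v, mem_of_mem_nhds hU₂⟩
  refine (h1.and_eventually h2).mono ?_
  rintro n ⟨hn, w, hw, hwn⟩
  exact ⟨w, hw, hsub ⟨hn, hwn⟩⟩

theorem isTransitivePoint_of_mem_totallyTransitivePts {x : unitInterval}
    (hx : x ∈ totallyTransitivePts f) : IsTransitivePoint f x := by
  refine dense_iff_inter_open.2 ?_
  rintro U hU ⟨u, hu⟩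
  obtain ⟨n, hn⟩ := (mapClusterPt_iff_frequently.1
    (mapClusterPt_of_mem_totallyTransitivePts hx u) U (hU.mem_nhds hu)).exists
  exact ⟨f^[n] x, hn, n, rfl⟩

theorem mapsTo_totallyTransitivePts (hc : Continuous f) (hs : Surjective f) :
    MapsTo f (totallyTransitivePts f) (totallyTransitivePts f) := by
  intro x hx m hm u
  obtain ⟨v, rfl⟩ := hs u
  have := (hx m hm v).continuousAt_comp hc.continuousAt
  refine this.congrFun (Eventually.of_forall fun n => ?_)
  simp only [comp_apply]
  rw [← iterate_succ_apply' f, iterate_succ_apply]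

theorem abs_coe_sub_coe_le_one (x y : unitInterval) : |(x : ℝ) - y| ≤ 1 := by
  rw [abs_le]
  constructor <;> linarith [x.2.1, x.2.2, y.2.1, y.2.2]

/-- Along multiples of the period `p` stands still while `x` still approaches every point, including
an endpoint at distance at least `1/2` from `p`. -/
theorem half_le_limsup_periodic {x p : unitInterval} (hx : x ∈ totallyTransitivePts f)
    (hp : p ∈ periodicPts f) :
    1 / 2 ≤ limsup (fun n : ℕ => |((f^[n] x : unitInterval) : ℝ) - (f^[n] p : unitInterval)|)
      atTop := by
  obtain ⟨m, hm, hpm⟩ := hp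
  obtain ⟨u, hu⟩ : ∃ u : unitInterval, 1 / 2 ≤ |(u : ℝ) - p| := by
    rcases le_total (1 / 2 : ℝ) p with h | h
    · refine ⟨0, ?_⟩
      rw [abs_sub_comm]
      simpa using h.trans (le_abs_self _)
    · refine ⟨1, le_trans ?_ (le_abs_self _)⟩
      push_cast
      linarith
  refine hu.trans (le_limsup_of_mapClusterPt ⟨1, fun n => abs_coe_sub_coe_le_one _ _⟩ ?_)
  refine MapClusterPt.of_comp (φ := fun n => m * n) (p := atTop)
    (tendsto_id.const_mul_atTop' hm) ?_
  have hcont : Continuous fun v : unitInterval => |(v : ℝ) - p| := by fun_prop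
  refine ((hx m hm u).continuousAt_comp hcont.continuousAt).congrFun
    (Eventually.of_forall fun n => ?_)
  have : f^[m * n] p = p := (hpm.mul_const n)
  simp only [comp_apply, this]

/-- The pair of orbits approaches preimages of `(0, 1)` and of `(0, 0)` under `f^[i] × f^[j]`. -/
theorem scrambled_of_jointlyTransitive (hc : Continuous f) (hs : Surjective f)
    {x y : unitInterval} {i j : ℕ} (h : JointlyTransitive f x y) :
    1 ≤ limsup (fun n : ℕ => |((f^[n] (f^[i] x) : unitInterval) : ℝ) -
        (f^[n] (f^[j] y) : unitInterval)|) atTop ∧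
      liminf (fun n : ℕ => |((f^[n] (f^[i] x) : unitInterval) : ℝ) -
        (f^[n] (f^[j] y) : unitInterval)|) atTop = 0 := by
  obtain ⟨u, hu⟩ := hs.iterate i 0
  obtain ⟨v, hv⟩ := hs.iterate j 1
  obtain ⟨w, hw⟩ := hs.iterate j 0
  have hcont : Continuous fun q : unitInterval × unitInterval =>
      |((f^[i] q.1 : unitInterval) : ℝ) - (f^[j] q.2 : unitInterval)| := by
    have := hc.iterate i
    have := hc.iterate j
    fun_prop
  have key : ∀ q : unitInterval × unitInterval,
      MapClusterPt |((f^[i] q.1 : unitInterval) : ℝ) - (f^[j] q.2 : unitInterval)| atTop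
        fun n : ℕ => |((f^[n] (f^[i] x) : unitInterval) : ℝ) -
          (f^[n] (f^[j] y) : unitInterval)| := by
    intro q
    refine ((h q).continuousAt_comp hcont.continuousAt).congrFun (Eventually.of_forall fun n => ?_)
    simp only [comp_apply, ← iterate_add_apply, add_comm]
  have k1 := key (u, v)
  have k0 := key (u, w)
  simp only [hu, hv, hw] at k1 k0
  norm_num at k1 k0
  exact ⟨le_limsup_of_mapClusterPt ⟨1, fun n => abs_coe_sub_coe_le_one _ _⟩ k1,
    liminf_eq_zero_of_mapClusterPt (fun n => abs_nonneg _)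
      ⟨1, fun n => abs_coe_sub_coe_le_one _ _⟩ k0⟩

/-- Joint transitivity is not available for `x` with itself. Instead `1 ↦ 0 ↦ 0` gives a point sent
to `1` by the smaller iterate and to `0` by the larger; approaching the fixed point `0` gives the
lower limit. -/
theorem scrambled_of_same_orbit (hc : Continuous f) (hs : Surjective f) (h0 : f 0 = 0)
    (h1 : f 1 = 0) {x : unitInterval} {i j : ℕ} (hij : i ≠ j)
    (hx : x ∈ totallyTransitivePts f) :
    1 ≤ limsup (fun n : ℕ => |((f^[n] (f^[i] x) : unitInterval) : ℝ) -
        (f^[n] (f^[j] x) : unitInterval)|) atTop ∧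
      liminf (fun n : ℕ => |((f^[n] (f^[i] x) : unitInterval) : ℝ) -
        (f^[n] (f^[j] x) : unitInterval)|) atTop = 0 := by
  have hz : ∀ n, f^[n] 0 = 0 := fun n => iterate_fixed h0 n
  have hlt : ∀ i j : ℕ, i < j → ∃ u, f^[i] u = 1 ∧ f^[j] u = 0 := by
    intro i j hij
    obtain ⟨u, hu⟩ := hs.iterate i 1
    obtain ⟨k, rfl⟩ := Nat.exists_eq_add_of_lt hij
    refine ⟨u, hu, ?_⟩
    rw [show i + k + 1 = (k + 1) + i by ring, iterate_add_apply, hu, iterate_succ_apply, h1, hz]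
  have hcont : Continuous fun q : unitInterval =>
      |((f^[i] q : unitInterval) : ℝ) - (f^[j] q : unitInterval)| := by
    have := hc.iterate i
    have := hc.iterate j
    fun_prop
  have key : ∀ q : unitInterval,
      MapClusterPt |((f^[i] q : unitInterval) : ℝ) - (f^[j] q : unitInterval)| atTop
        fun n : ℕ => |((f^[n] (f^[i] x) : unitInterval) : ℝ) -
          (f^[n] (f^[j] x) : unitInterval)| := by
    intro q
    refine ((mapClusterPt_of_mem_totallyTransitivePts hx q).continuousAt_comp
      hcont.continuousAt).congrFun (Eventually.of_forall fun n => ?_)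
    simp only [comp_apply, ← iterate_add_apply, add_comm]
  have k0 := key 0
  simp only [hz, sub_self, abs_zero] at k0
  refine ⟨le_limsup_of_mapClusterPt ⟨1, fun n => abs_coe_sub_coe_le_one _ _⟩ ?_,
    liminf_eq_zero_of_mapClusterPt (fun n => abs_nonneg _)
      ⟨1, fun n => abs_coe_sub_coe_le_one _ _⟩ k0⟩
  rcases hij.lt_or_gt with h | h
  · obtain ⟨u, hu1, hu0⟩ := hlt i j h
    simpa [hu1, hu0] using key u
  · obtain ⟨u, hu1, hu0⟩ := hlt j i h
    simpa [hu1, hu0] using key u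

theorem LocallyEventuallyOnto.exists_isScrambledSet (hf : LocallyEventuallyOnto f)
    (hc : Continuous f) (hs : Surjective f) (h0 : f 0 = 0) (h1 : f 1 = 0) :
    ∃ S : Set unitInterval, Dense S ∧ ¬ S.Countable ∧ MapsTo f S S ∧
      IsScrambledSet f 1 S ∧ ∀ x ∈ S, IsTransitivePoint f x := by
  obtain ⟨S₀, hS₀, hunc, hpair⟩ := exists_uncountable_pairwise
    (hf.totallyTransitivePts_mem_residual hc) (fun _ _ => JointlyTransitive.symm)
    (fun x hx => hf.residual_jointlyTransitive hc hx)
  -- Adjoining all forward orbits makes the set invariant, and dense because each orbit is.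
  have hS₀S : S₀ ⊆ {z | ∃ x ∈ S₀, ∃ i : ℕ, f^[i] x = z} := fun x hx => ⟨x, hx, 0, rfl⟩
  have hSA : ∀ z ∈ {z | ∃ x ∈ S₀, ∃ i : ℕ, f^[i] x = z}, z ∈ totallyTransitivePts f := by
    rintro _ ⟨x, hx, i, rfl⟩
    exact (mapsTo_totallyTransitivePts hc hs).iterate i (hS₀ hx)
  have hscr : ∀ z ∈ {z | ∃ x ∈ S₀, ∃ i : ℕ, f^[i] x = z},
      ∀ w ∈ {z | ∃ x ∈ S₀, ∃ i : ℕ, f^[i] x = z}, z ≠ w →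
      1 ≤ limsup (fun n : ℕ => |((f^[n] z : unitInterval) : ℝ) - (f^[n] w : unitInterval)|) atTop ∧
      liminf (fun n : ℕ => |((f^[n] z : unitInterval) : ℝ) - (f^[n] w : unitInterval)|) atTop
        = 0 := by
    rintro _ ⟨x, hx, i, rfl⟩ _ ⟨y, hy, j, rfl⟩ hne
    by_cases hxy : x = y
    · subst hxy
      exact scrambled_of_same_orbit hc hs h0 h1 (fun hij => hne (by rw [hij])) (hS₀ hx)
    · exact scrambled_of_jointlyTransitive hc hs (hpair hx hy hxy)
  refine ⟨{z | ∃ x ∈ S₀, ∃ i : ℕ, f^[i] x = z}, ?_, fun h => hunc (h.mono hS₀S), ?_,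
    ⟨one_pos, fun z hz w hw hne => (hscr z hz w hw hne).1,
      fun z hz w hw hne => (hscr z hz w hw hne).2,
      fun z hz p hp => half_le_limsup_periodic (hSA z hz) hp⟩,
    fun z hz => isTransitivePoint_of_mem_totallyTransitivePts (hSA z hz)⟩
  · obtain ⟨x, hx⟩ : S₀.Nonempty :=
      nonempty_iff_ne_empty.2 fun h => hunc (h ▸ countable_empty)
    refine (isTransitivePoint_of_mem_totallyTransitivePts (hS₀ hx)).mono ?_
    rintro _ ⟨k, rfl⟩
    exact ⟨x, hx, k, rfl⟩
  · rintro _ ⟨x, hx, i, rfl⟩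
    exact ⟨x, hx, i + 1, iterate_succ_apply' f i x⟩

end Interval

/-! ### The semiconjugacy to the tent map -/

section Unimodal

/-- Unimodal maps of the unit interval both of whose laps cover the interval. -/
structure IsFullUnimodal (f : unitInterval → unitInterval) (a : unitInterval) : Prop where
  continuous : Continuous f
  map_zero : f 0 = 0
  map_one : f 1 = 0
  map_top : f a = 1
  strictMonoOn : StrictMonoOn f (Icc 0 a)
  strictAntiOn : StrictAntiOn f (Icc a 1)

theorem tentMap_coe_of_le {x : unitInterval} (hx : (x : ℝ) ≤ 1 / 2) :
    (tentMap x : ℝ) = 2 * x := by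
  simp only [tentMap]
  rw [abs_of_nonpos (by linarith)]
  ring

theorem tentMap_coe_of_ge {x : unitInterval} (hx : 1 / 2 ≤ (x : ℝ)) :
    (tentMap x : ℝ) = 2 - 2 * x := by
  simp only [tentMap]
  rw [abs_of_nonneg (by linarith)]
  ring

theorem tentMap_symm (x : unitInterval) : tentMap (σ x) = tentMap x := by
  apply Subtype.ext
  simp only [tentMap, coe_symm_eq]
  rw [show 2 * (1 - (x : ℝ)) - 1 = -(2 * x - 1) by ring, abs_neg]

theorem eq_or_eq_symm_of_tentMap_eq {x y : unitInterval} (h : tentMap x = tentMap y) :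
    x = y ∨ x = σ y := by
  have h' := congrArg (Subtype.val) h
  simp only [tentMap] at h'
  rcases abs_eq_abs.1 (show |2 * (x : ℝ) - 1| = |2 * (y : ℝ) - 1| by linarith) with h | h
  · left; apply Subtype.ext; linarith
  · right; apply Subtype.ext; rw [coe_symm_eq]; linarith

/-- The turning point is absorbed: `1/2 ↦ 1 ↦ 0 ↦ 0`. -/
theorem coe_ne_half_of_mem_periodicPts_tentMap {x : unitInterval}
    (hx : x ∈ periodicPts tentMap) : (x : ℝ) ≠ 1 / 2 := by
  intro h
  obtain ⟨n, hn, hxn⟩ := hx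
  have h1 : tentMap x = 1 := by
    apply Subtype.ext
    rw [tentMap_coe_of_le h.le, h]
    norm_num
  have h2 : tentMap 1 = 0 := by
    apply Subtype.ext
    rw [tentMap_coe_of_ge (by norm_num)]
    norm_num
  have h3 : tentMap 0 = 0 := by
    apply Subtype.ext
    rw [tentMap_coe_of_le (by norm_num)]
    norm_num
  have hxn' : tentMap^[n] x = x := hxn
  rcases n with _ | _ | n
  · omega
  · simp only [zero_add, iterate_one] at hxn'
    rw [← hxn', h1] at h
    norm_num at h
  · rw [iterate_succ_apply, iterate_succ_apply, h1, h2, iterate_fixed h3] at hxn'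
    rw [← hxn'] at h
    norm_num at h

/-- Some preimage of any point under any iterate of the tent map is close to any given point. -/
theorem exists_close_tentMap_iterate_eq (n : ℕ) (x z : unitInterval) :
    ∃ u : unitInterval, |(x : ℝ) - u| ≤ (1 / 2) ^ n ∧ tentMap^[n] u = z := by
  induction n generalizing x with
  | zero => exact ⟨z, by simpa using abs_coe_sub_coe_le_one x z, rfl⟩
  | succ n ih =>
    obtain ⟨u, hu, rfl⟩ := ih (tentMap x)
    have hu0 := u.2.1
    have hu1 := u.2.2
    rcases le_total (x : ℝ) (1 / 2) with h | h
    · refine ⟨⟨u / 2, by linarith, by linarith⟩, ?_, ?_⟩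
      · rw [tentMap_coe_of_le h] at hu
        rw [show (x : ℝ) - u / 2 = (2 * x - u) * (1 / 2) by ring, abs_mul, pow_succ]
        norm_num at hu ⊢
        exact hu
      · rw [iterate_succ_apply]
        congr 1
        apply Subtype.ext
        rw [tentMap_coe_of_le (by simp only; linarith)]
        simp only; ring
    · refine ⟨⟨1 - u / 2, by linarith, by linarith⟩, ?_, ?_⟩
      · rw [tentMap_coe_of_ge h] at hu
        rw [show (x : ℝ) - (1 - u / 2) = -(2 - 2 * x - u) * (1 / 2) by ring, abs_mul, pow_succ,
          abs_neg]
        norm_num at hu ⊢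
        exact hu
      · rw [iterate_succ_apply]
        congr 1
        apply Subtype.ext
        rw [tentMap_coe_of_ge (by simp only; linarith)]
        simp only; ring

theorem locallyEventuallyOnto_tentMap : LocallyEventuallyOnto tentMap := by
  intro x W hW
  obtain ⟨ε, hε, hball⟩ := Metric.mem_nhds_iff.1 hW
  have ht : Tendsto (fun n : ℕ => (1 / 2 : ℝ) ^ n) atTop (𝓝 0) :=
    tendsto_pow_atTop_nhds_zero_of_lt_one (by norm_num) (by norm_num)
  filter_upwards [ht.eventually (Iio_mem_nhds hε)] with n hn
  refine eq_univ_of_forall fun z => ?_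
  obtain ⟨u, hu, rfl⟩ := exists_close_tentMap_iterate_eq n x z
  refine ⟨u, hball ?_, rfl⟩
  rw [Metric.mem_ball, dist_comm, Subtype.dist_eq, Real.dist_eq]
  exact hu.trans_lt hn

theorem LocallyEventuallyOnto.of_semiconj {X Y : Type*} [TopologicalSpace X] [TopologicalSpace Y]
    {f : X → X} {g : Y → Y} (hg : LocallyEventuallyOnto g) (e : X ≃ₜ Y) (he : Semiconj e f g) :
    LocallyEventuallyOnto f := by
  intro x W hW
  filter_upwards [hg (e x) (e '' W) (e.isOpenMap.image_mem_nhds hW)] with n hn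
  refine eq_univ_of_forall fun z => ?_
  obtain ⟨_, ⟨w, hw, rfl⟩, hwz⟩ : e z ∈ g^[n] '' (e '' W) := hn ▸ mem_univ _
  refine ⟨w, hw, e.injective ?_⟩
  rw [(he.iterate_right n).eq, hwz]

variable {f : unitInterval → unitInterval} {a : unitInterval}

/-- The functional equation for a semiconjugacy from `f` to the tent map has a contracting
right-hand side on the monotone functions which fix both endpoints. -/
theorem IsFullUnimodal.exists_functionalEquation (hf : IsFullUnimodal f a) :
    ∃ h : C(unitInterval, ℝ), Monotone h ∧ h 0 = 0 ∧ h 1 = 1 ∧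
      ∀ x, h x = if x ≤ a then h (f x) / 2 else 1 - h (f x) / 2 := by
  have hcl : IsClosed {h : C(unitInterval, ℝ) | Monotone h ∧ h 0 = 0 ∧ h 1 = 1} := by
    refine IsClosed.inter ?_ (IsClosed.inter ?_ ?_)
    · exact isClosed_monotone.preimage (f := fun h : C(unitInterval, ℝ) => (h : unitInterval → ℝ))
        (continuous_pi fun x => by fun_prop)
    · exact isClosed_eq (by fun_prop) continuous_const
    · exact isClosed_eq (by fun_prop) continuous_const
  have := hcl.completeSpace_coe
  have ha1 : a < 1 := lt_of_le_of_ne le_one' fun h => by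
    have := hf.map_top
    rw [h, hf.map_one] at this
    exact zero_ne_one this
  let Φ : {h : C(unitInterval, ℝ) | Monotone h ∧ h 0 = 0 ∧ h 1 = 1} →
      {h : C(unitInterval, ℝ) | Monotone h ∧ h 0 = 0 ∧ h 1 = 1} := fun h =>
    ⟨⟨fun x => if x ≤ a then h.1 (f x) / 2 else 1 - h.1 (f x) / 2, by
        have := hf.continuous
        -- At `x = a` both branches equal `1/2`, since `h (f a) = h 1 = 1`.
        refine Continuous.if_le (by fun_prop) (by fun_prop) continuous_id continuous_const ?_
        rintro x rfl
        rw [hf.map_top, h.2.2.2]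
        norm_num⟩, by
      obtain ⟨h, hm, h0, h1⟩ := h
      have hle : ∀ x, h x ≤ 1 := fun x => h1 ▸ hm le_one'
      refine ⟨?_, ?_, ?_⟩
      · intro x y hxy
        simp only [ContinuousMap.coe_mk]
        split_ifs with hx hy hy
        · have := hm (hf.strictMonoOn.monotoneOn ⟨nonneg', hx⟩ ⟨nonneg', hy⟩ hxy)
          linarith
        · linarith [hle (f x), hle (f y)]
        · exact absurd (hxy.trans hy) hx
        · have := hm (hf.strictAntiOn.antitoneOn ⟨(not_le.1 hx).le, le_one'⟩
            ⟨(not_le.1 hy).le, le_one'⟩ hxy)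
          linarith
      · simp [hf.map_zero, h0]
      · simp [hf.map_one, h0, not_le.2 ha1]⟩
  have hΦ : ContractingWith (1 / 2) Φ := by
    refine ⟨by rw [← NNReal.coe_lt_coe]; norm_num, LipschitzWith.of_dist_le_mul fun h k => ?_⟩
    rw [Subtype.dist_eq, Subtype.dist_eq, ContinuousMap.dist_le (by positivity)]
    intro x
    have hd := ContinuousMap.dist_apply_le_dist (f := h.1) (g := k.1) (f x)
    rw [Real.dist_eq] at hd ⊢
    simp only [Φ, ContinuousMap.coe_mk]
    push_cast
    split_ifs
    · rw [show h.1 (f x) / 2 - k.1 (f x) / 2 = 1 / 2 * (h.1 (f x) - k.1 (f x)) by ring, abs_mul,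
        abs_of_pos (by norm_num : (0 : ℝ) < 1 / 2)]
      linarith
    · rw [show 1 - h.1 (f x) / 2 - (1 - k.1 (f x) / 2) = -(1 / 2 * (h.1 (f x) - k.1 (f x))) by ring,
        abs_neg, abs_mul, abs_of_pos (by norm_num : (0 : ℝ) < 1 / 2)]
      linarith
  obtain ⟨h, hh, -⟩ := hΦ.exists_fixedPoint
    ⟨⟨fun x => (x : ℝ), by fun_prop⟩, fun x y hxy => hxy, by simp, by simp⟩ (edist_ne_top _ _)
  refine ⟨h.1, h.2.1, h.2.2.1, h.2.2.2, fun x => ?_⟩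
  exact congrArg (fun k : {h : C(unitInterval, ℝ) | Monotone h ∧ h 0 = 0 ∧ h 1 = 1} => k.1 x)
    hh.symm

/-- Monotone semiconjugacies from `f` to the tent map, taking turning point to turning point. -/
structure IsTentSemiconj (f h : unitInterval → unitInterval) (a : unitInterval) : Prop where
  continuous : Continuous h
  monotone : Monotone h
  map_top : (h a : ℝ) = 1 / 2
  semiconj : Semiconj h f tentMap
  surjective : Surjective h

theorem IsFullUnimodal.exists_isTentSemiconj (hf : IsFullUnimodal f a) :
    ∃ h, IsTentSemiconj f h a := by
  obtain ⟨h, hm, h0, h1, hfe⟩ := hf.exists_functionalEquation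
  have hmem : ∀ x, h x ∈ unitInterval := fun x => ⟨h0 ▸ hm nonneg', h1 ▸ hm le_one'⟩
  have hcont : Continuous fun x => (⟨h x, hmem x⟩ : unitInterval) := by fun_prop
  refine ⟨fun x => ⟨h x, hmem x⟩, hcont, fun x y hxy => hm hxy, ?_, fun x => ?_, fun y => ?_⟩
  · simp only
    rw [hfe, if_pos le_rfl, hf.map_top, h1]
  · apply Subtype.ext
    have hfx := hfe x
    have hle := (hmem (f x)).2
    split_ifs at hfx with hx
    · rw [tentMap_coe_of_le (by simp only; linarith)]
      simp only; linarith
    · rw [tentMap_coe_of_ge (by simp only; linarith)]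
      simp only; linarith
  · refine mem_range_of_exists_le_of_exists_ge hcont ⟨0, ?_⟩ ⟨1, ?_⟩
    · exact Subtype.coe_le_coe.1 (h0.le.trans y.2.1)
    · exact Subtype.coe_le_coe.1 (y.2.2.trans h1.ge)

end Unimodal

/-! ### Nondegenerate fibres; dense orbits and dense periodic points -/

section Fibres

variable {f h : unitInterval → unitInterval} {a : unitInterval}

theorem IsTentSemiconj.le_of_lt (hh : IsTentSemiconj f h a) {x : unitInterval}
    (hx : (h x : ℝ) < 1 / 2) : x ≤ a :=
  (hh.monotone.reflect_lt (Subtype.coe_lt_coe.1 (hh.map_top.symm ▸ hx))).le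

theorem IsTentSemiconj.ge_of_gt (hh : IsTentSemiconj f h a) {x : unitInterval}
    (hx : 1 / 2 < (h x : ℝ)) : a ≤ x :=
  (hh.monotone.reflect_lt (Subtype.coe_lt_coe.1 (hh.map_top.symm ▸ hx))).le

theorem IsTentSemiconj.fibre_subset (hh : IsTentSemiconj f h a) {t : unitInterval}
    (ht : (t : ℝ) ≠ 1 / 2) : h ⁻¹' {t} ⊆ Icc 0 a ∨ h ⁻¹' {t} ⊆ Icc a 1 := by
  rcases ht.lt_or_gt with ht | ht
  · left
    rintro x rfl
    exact ⟨nonneg', hh.le_of_lt ht⟩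
  · right
    rintro x rfl
    exact ⟨hh.ge_of_gt ht, le_one'⟩

theorem IsTentSemiconj.injOn_fibre (hh : IsTentSemiconj f h a) (hf : IsFullUnimodal f a)
    {t : unitInterval} (ht : (t : ℝ) ≠ 1 / 2) : InjOn f (h ⁻¹' {t}) := by
  rcases hh.fibre_subset ht with hs | hs
  · exact hf.strictMonoOn.injOn.mono hs
  · exact hf.strictAntiOn.injOn.mono hs

theorem IsTentSemiconj.mapsTo_fibre (hh : IsTentSemiconj f h a) (t : unitInterval) (n : ℕ) :
    MapsTo f^[n] (h ⁻¹' {t}) (h ⁻¹' {tentMap^[n] t}) := by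
  rintro x rfl
  exact (hh.semiconj.iterate_right n).eq x

theorem IsTentSemiconj.ordConnected_fibre (hh : IsTentSemiconj f h a) (t : unitInterval) :
    OrdConnected (h ⁻¹' {t}) :=
  ordConnected_singleton.preimage_mono hh.monotone

theorem IsFullUnimodal.eq_of_map_eq_one (hf : IsFullUnimodal f a) {x : unitInterval}
    (hx : f x = 1) : x = a := by
  rcases le_total x a with h | h
  · exact hf.strictMonoOn.injOn ⟨nonneg', h⟩ ⟨nonneg', le_rfl⟩ (hx.trans hf.map_top.symm)
  · exact hf.strictAntiOn.injOn ⟨h, le_one'⟩ ⟨le_rfl, le_one'⟩ (hx.trans hf.map_top.symm)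

/-- Away from `1/2` a fibre lies in one lap, where `f` is injective. The fibre over `1/2` contains
`a`, the only preimage of `1`. -/
theorem IsTentSemiconj.nontrivial_fibre_tentMap (hh : IsTentSemiconj f h a)
    (hf : IsFullUnimodal f a) {t : unitInterval} (ht : (h ⁻¹' {t}).Nontrivial) :
    (h ⁻¹' {tentMap t}).Nontrivial := by
  have hmaps : MapsTo f (h ⁻¹' {t}) (h ⁻¹' {tentMap t}) := hh.mapsTo_fibre t 1
  by_cases hhalf : (t : ℝ) = 1 / 2
  · have hta : a ∈ h ⁻¹' {t} := Subtype.ext (hh.map_top.trans hhalf.symm)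
    obtain ⟨w, hw, hwa⟩ := ht.exists_ne a
    exact ⟨f w, hmaps hw, f a, hmaps hta, fun h =>
      hwa (hf.eq_of_map_eq_one (h.trans hf.map_top))⟩
  · obtain ⟨u, hu, v, hv, huv⟩ := ht
    exact ⟨f u, hmaps hu, f v, hmaps hv, fun h => huv (hh.injOn_fibre hf hhalf hu hv h)⟩

theorem IsTentSemiconj.nontrivial_fibre_iterate (hh : IsTentSemiconj f h a)
    (hf : IsFullUnimodal f a) {t : unitInterval} (ht : (h ⁻¹' {t}).Nontrivial) (n : ℕ) :
    (h ⁻¹' {tentMap^[n] t}).Nontrivial := by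
  induction n with
  | zero => exact ht
  | succ n ih =>
    rw [iterate_succ_apply']
    exact hh.nontrivial_fibre_tentMap hf ih

/-- The point on the other lap with the same image lies in the reflected fibre. -/
theorem IsTentSemiconj.exists_twin (hh : IsTentSemiconj f h a) (hf : IsFullUnimodal f a)
    (x : unitInterval) : ∃ y, f y = f x ∧ h y = σ (h x) := by
  have hside : ∃ y, f y = f x ∧ (x ≤ a ∧ a ≤ y ∨ a ≤ x ∧ y ≤ a) := by
    rcases le_total x a with hx | hx
    · have := intermediate_value_Icc' (le_one' (t := a)) hf.continuous.continuousOn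
      rw [hf.map_one, hf.map_top] at this
      obtain ⟨y, hy, hyx⟩ := this ⟨nonneg', le_one' (t := f x)⟩
      exact ⟨y, hyx, Or.inl ⟨hx, hy.1⟩⟩
    · have := intermediate_value_Icc (nonneg' (t := a)) hf.continuous.continuousOn
      rw [hf.map_zero, hf.map_top] at this
      obtain ⟨y, hy, hyx⟩ := this ⟨nonneg', le_one' (t := f x)⟩
      exact ⟨y, hyx, Or.inr ⟨hx, hy.2⟩⟩
  obtain ⟨y, hyx, hs⟩ := hside
  refine ⟨y, hyx, ?_⟩
  have ht : tentMap (h y) = tentMap (h x) := by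
    rw [← hh.semiconj.eq, ← hh.semiconj.eq, hyx]
  rcases eq_or_eq_symm_of_tentMap_eq ht with heq | heq
  · have h1 : (h x : ℝ) = 1 / 2 := by
      have key : ∀ x y, x ≤ y → (h x : ℝ) ≤ h y := fun x y hxy => hh.monotone hxy
      have hxy : (h y : ℝ) = h x := congrArg _ heq
      rcases hs with ⟨h1, h2⟩ | ⟨h1, h2⟩
      all_goals
        have := key _ _ h1
        have := key _ _ h2
        linarith [hh.map_top]
    rw [heq]
    apply Subtype.ext
    rw [coe_symm_eq, h1]
    norm_num
  · exact heq

theorem IsTentSemiconj.nontrivial_fibre_symm (hh : IsTentSemiconj f h a)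
    (hf : IsFullUnimodal f a) {t : unitInterval} (hhalf : (t : ℝ) ≠ 1 / 2)
    (ht : (h ⁻¹' {t}).Nontrivial) : (h ⁻¹' {σ t}).Nontrivial := by
  obtain ⟨u, hu, v, hv, huv⟩ := ht
  obtain ⟨u', hfu, hu'⟩ := hh.exists_twin hf u
  obtain ⟨v', hfv, hv'⟩ := hh.exists_twin hf v
  refine ⟨u', ?_, v', ?_, fun heq => huv (hh.injOn_fibre hf hhalf hu hv ?_)⟩
  · rw [mem_preimage, hu', hu]; rfl
  · rw [mem_preimage, hv', hv]; rfl
  · rw [← hfu, ← hfv, heq]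

theorem IsTentSemiconj.exists_Icc_subset (hh : IsTentSemiconj f h a) {t : unitInterval}
    (ht : (h ⁻¹' {t}).Nontrivial) : ∃ u v, u < v ∧ Icc u v ⊆ h ⁻¹' {t} := by
  obtain ⟨u, hu, v, hv, huv⟩ := ht.exists_lt
  exact ⟨u, v, huv, (hh.ordConnected_fibre t).out hu hv⟩

theorem injective_of_forall_not_nontrivial_fibre {X Y : Type*} {h : X → Y}
    (H : ∀ t, ¬ (h ⁻¹' {t}).Nontrivial) : Injective h := by
  intro x y hxy
  by_contra hne
  exact H (h x) ⟨x, rfl, y, hxy.symm, hne⟩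

theorem finite_orbitOf_of_iterate_eq {X : Type*} {g : X → X} {x : X} {n m : ℕ} (hnm : n < m)
    (h : g^[n] x = g^[m] x) : (orbitOf g x).Finite := by
  refine ((finite_lt_nat m).image fun k => g^[k] x).subset ?_
  rintro _ ⟨k, rfl⟩
  induction k using Nat.strong_induction_on with
  | _ k ih =>
    by_cases hk : k < m
    · exact ⟨k, hk, rfl⟩
    · have : g^[k] x = g^[k - m + n] x := by
        rw [iterate_add_apply, h, ← iterate_add_apply, Nat.sub_add_cancel (not_lt.1 hk)]
      simp only [this]
      exact ih _ (by omega)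

theorem exists_iterate_mem_of_dense_orbitOf {X : Type*} [TopologicalSpace X] [T1Space X]
    [∀ x : X, NeBot (𝓝[≠] x)] {g : X → X} {x : X} (hx : Dense (orbitOf g x)) {U : Set X}
    (hU : IsOpen U) (hUn : U.Nonempty) (N : ℕ) : ∃ n ≥ N, g^[n] x ∈ U := by
  have hfin := (finite_lt_nat N).image fun k => g^[k] x
  obtain ⟨_, hyU, ⟨k, rfl⟩, hk⟩ := dense_iff_inter_open.1 (hx.sdiff_finite hfin) U hU hUn
  exact ⟨k, not_lt.1 fun hlt => hk ⟨k, hlt, rfl⟩, hyU⟩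

theorem IsTentSemiconj.injective_of_dense_orbitOf (hh : IsTentSemiconj f h a) {x : unitInterval}
    (hx : Dense (orbitOf f x)) : Injective h := by
  refine injective_of_forall_not_nontrivial_fibre fun t ht => ?_
  obtain ⟨u, v, huv, hsub⟩ := hh.exists_Icc_subset ht
  have hn := exists_iterate_mem_of_dense_orbitOf hx isOpen_Ioo (nonempty_Ioo.2 huv)
  obtain ⟨n, -, hn1⟩ := hn 0
  obtain ⟨m, hnm, hm1⟩ := hn (n + 1)
  have himg : ∀ k, h (f^[k] x) = tentMap^[k] (h x) := fun k => (hh.semiconj.iterate_right k).eq x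
  have heq : tentMap^[n] (h x) = tentMap^[m] (h x) := by
    rw [← himg, ← himg]
    exact (hsub (Ioo_subset_Icc_self hn1)).trans (hsub (Ioo_subset_Icc_self hm1)).symm
  have hfin := finite_orbitOf_of_iterate_eq hnm heq
  have hd := hh.surjective.denseRange.dense_image hh.continuous hx
  have himage : h '' orbitOf f x = orbitOf tentMap (h x) := by
    rw [orbitOf, orbitOf, ← range_comp]
    exact congrArg range (funext himg)
  rw [himage] at hd
  have huniv := hfin.isClosed.closure_eq ▸ hd.closure_eq
  have : Infinite unitInterval := (Icc_infinite (zero_lt_one (α := ℝ))).to_subtype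
  exact infinite_univ (huniv ▸ hfin)

theorem IsTentSemiconj.injective_of_dense_periodicPts (hh : IsTentSemiconj f h a)
    (hf : IsFullUnimodal f a) (hd : Dense (periodicPts f)) : Injective h := by
  have key : ∀ t, (h ⁻¹' {t}).Nontrivial → t ∈ periodicPts tentMap := by
    intro t ht
    obtain ⟨u, v, huv, hsub⟩ := hh.exists_Icc_subset ht
    obtain ⟨p, hp, n, hn, hpn⟩ := dense_iff_inter_open.1 hd _ isOpen_Ioo (nonempty_Ioo.2 huv)
    have hpt : h p = t := hsub (Ioo_subset_Icc_self hp)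
    exact ⟨n, hn, hpt ▸ hpn.map hh.semiconj⟩
  refine injective_of_forall_not_nontrivial_fibre fun t ht => ?_
  have hper := key t ht
  have hhalf := coe_ne_half_of_mem_periodicPts_tentMap hper
  obtain ⟨n, hn, hnt⟩ := hper
  obtain ⟨m, hm, hmt⟩ := key _ (hh.nontrivial_fibre_symm hf hhalf ht)
  -- Over the common period `n * m`, equal first images return to equal points, so `t = σ t`.
  have h1 : tentMap^[n * m] t = t := hnt.mul_const m
  have h2 : tentMap^[n * m] (σ t) = σ t := hmt.const_mul n
  obtain ⟨k, hk⟩ := Nat.exists_eq_succ_of_ne_zero (Nat.mul_pos hn hm).ne'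
  rw [hk, iterate_succ_apply] at h1 h2
  rw [tentMap_symm, h1] at h2
  refine hhalf ?_
  have h3 := congrArg Subtype.val h2
  rw [coe_symm_eq] at h3
  linarith

end Fibres

/-! ### Points of equicontinuity -/

section Equicontinuity

theorem equicontinuousAt_of_shrinking {X Y : Type*} [TopologicalSpace X] [PseudoMetricSpace Y]
    {g : ℕ → X → Y} (hg : ∀ n, Continuous (g n)) {x : X} {s : Set X} (hs : s ∈ 𝓝 x)
    (H : ∀ ε > 0, ∀ᶠ n in atTop, ∀ y ∈ s, dist (g n x) (g n y) < ε) : EquicontinuousAt g x := by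
  rw [Metric.equicontinuousAt_iff_right]
  intro ε hε
  obtain ⟨N, hN⟩ := eventually_atTop.1 (H ε hε)
  have hfin : ∀ᶠ y in 𝓝 x, ∀ n ∈ {n | n < N}, dist (g n x) (g n y) < ε := by
    rw [eventually_all_finite (finite_lt_nat N)]
    intro n _
    have : Tendsto (fun y => dist (g n x) (g n y)) (𝓝 x) (𝓝 (dist (g n x) (g n x))) :=
      (continuous_const.dist (hg n)).continuousAt
    rw [dist_self] at this
    exact this.eventually (Iio_mem_nhds hε)
  filter_upwards [hfin, hs] with y hy hys n
  by_cases hn : n < N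
  · exact hy n hn
  · exact hN n (not_lt.1 hn) y hys

/-- Write `n = q * (n / q) + n % q`; the finitely many remainders are absorbed by uniform
continuity. -/
theorem equicontinuousAt_iterate_of_power {X : Type*} [UniformSpace X] {f : X → X}
    (hf : UniformContinuous f) {q : ℕ} (hq : 0 < q) {x : X}
    (h : EquicontinuousAt (fun k => (f^[q])^[k]) x) : EquicontinuousAt (fun n => f^[n]) x := by
  intro U hU
  have hV : ∀ᶠ p in uniformity X, ∀ r ∈ {r | r < q}, (f^[r] p.1, f^[r] p.2) ∈ U := by
    rw [eventually_all_finite (finite_lt_nat q)]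
    intro r _
    exact (hf.iterate f r) hU
  filter_upwards [h _ hV] with y hy n
  have := hy (n / q) (n % q) (Nat.mod_lt n hq)
  rwa [← iterate_mul, ← iterate_add_apply, ← iterate_add_apply, Nat.mod_add_div] at this

theorem not_sensitiveDependence_of_equicontinuousAt {f : unitInterval → unitInterval}
    {x : unitInterval} (h : EquicontinuousAt (fun n => f^[n]) x) : ¬ SensitiveDependence f := by
  rintro ⟨δ, hδ, H⟩
  obtain ⟨V, hV, hVo, hxV⟩ := eventually_nhds_iff.1 (Metric.equicontinuousAt_iff_right.1 h δ hδ)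
  obtain ⟨y, hy, n, -, hn⟩ := H x V hVo hxV
  exact absurd (hV y hy n) (not_lt.2 hn)

/-- A finite `ε/2`-net has a point near each midpoint. Hence only finitely many of a family of
disjoint intervals can be long. -/
theorem exists_finite_meets_long_uIcc {ε : ℝ} (hε : 0 < ε) :
    ∃ C : Set unitInterval, C.Finite ∧
      ∀ p q : unitInterval, ε ≤ dist p q → ∃ c ∈ C, c ∈ uIcc p q := by
  obtain ⟨C, -, hC, hcov⟩ := finite_cover_balls_of_compact
    (isCompact_univ (X := unitInterval)) (half_pos hε)
  refine ⟨C, hC, ?_⟩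
  have key : ∀ p q : unitInterval, p ≤ q → ε ≤ dist p q → ∃ c ∈ C, c ∈ uIcc p q := by
    intro p q hpq hd
    have hpq' : (p : ℝ) ≤ q := hpq
    obtain ⟨c, hcC, hc⟩ := mem_iUnion₂.1 (hcov (mem_univ
      (⟨((p : ℝ) + q) / 2, by linarith [p.2.1, q.2.1], by linarith [p.2.2, q.2.2]⟩ : unitInterval)))
    rw [Metric.mem_ball, Subtype.dist_eq, Real.dist_eq] at hc
    rw [Subtype.dist_eq, dist_comm, Real.dist_eq, abs_of_nonneg (by linarith)] at hd
    obtain ⟨h1, h2⟩ := abs_lt.1 hc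
    simp only at h1 h2
    refine ⟨c, hcC, Icc_subset_uIcc ⟨?_, ?_⟩⟩
    · exact Subtype.coe_le_coe.1 (by linarith)
    · exact Subtype.coe_le_coe.1 (by linarith)
  intro p q hd
  rcases le_total p q with hpq | hpq
  · exact key p q hpq hd
  · rw [uIcc_comm]
    exact key q p hpq (by rwa [dist_comm])

/-- A map increasing on an interval which it preserves is equicontinuous somewhere. -/
theorem exists_equicontinuousAt_of_monotoneOn {g : unitInterval → unitInterval}
    (hg : Continuous g) {F : Set unitInterval} (hF : OrdConnected F) (hFn : F.Nontrivial)
    (hmaps : MapsTo g F F) (hmono : MonotoneOn g F) :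
    ∃ x, EquicontinuousAt (fun k => g^[k]) x := by
  by_cases hfix : ∀ z ∈ F, g z = z
  · obtain ⟨u, hu, v, hv, huv⟩ := hFn.exists_lt
    obtain ⟨x, hx⟩ := exists_between huv
    have hfix' : ∀ y ∈ Ioo u v, ∀ k, g^[k] y = y := fun y hy k =>
      iterate_fixed (hfix y (hF.out hu hv (Ioo_subset_Icc_self hy))) k
    refine ⟨x, fun U hU => ?_⟩
    filter_upwards [mem_nhds_left x hU, Ioo_mem_nhds hx.1 hx.2] with y hy hyI k
    simpa only [hfix' x hx, hfix' y hyI] using hy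
  · push Not at hfix
    obtain ⟨z, hzF, hz⟩ := hfix
    have hzk : ∀ k, g^[k] z ∈ F := fun k => hmaps.iterate k hzF
    -- The orbit of a non-fixed `z` is monotone, so the intervals between consecutive iterates,
    -- which contain the images of `uIcc z (g z)`, collapse to its limit.
    obtain ⟨L, hL⟩ : ∃ L, Tendsto (fun k => g^[k] z) atTop (𝓝 L) := by
      rcases hz.lt_or_gt with hlt | hlt
      · refine ⟨_, tendsto_atTop_iInf (antitone_nat_of_succ_le fun k => ?_)⟩
        induction k with
        | zero => exact hlt.le
        | succ k ih =>
          rw [iterate_succ_apply' g (k + 1), iterate_succ_apply' g k]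
          exact hmono (iterate_succ_apply' g k z ▸ hzk (k + 1)) (hzk k)
            (iterate_succ_apply' g k z ▸ ih)
      · refine ⟨_, tendsto_atTop_iSup (monotone_nat_of_le_succ fun k => ?_)⟩
        induction k with
        | zero => exact hlt.le
        | succ k ih =>
          rw [iterate_succ_apply' g (k + 1), iterate_succ_apply' g k]
          exact hmono (hzk k) (iterate_succ_apply' g k z ▸ hzk (k + 1))
            (iterate_succ_apply' g k z ▸ ih)
    have hsub : ∀ k, ∀ y ∈ uIcc z (g z), g^[k] y ∈ uIcc (g^[k] z) (g^[k + 1] z) := by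
      intro k
      induction k with
      | zero => exact fun y hy => hy
      | succ k ih =>
        intro y hy
        have hs := hF.uIcc_subset (hzk k) (hzk (k + 1))
        have := (hmono.mono hs).mapsTo_uIcc (ih y hy)
        rwa [← iterate_succ_apply' g, ← iterate_succ_apply' g, ← iterate_succ_apply' g] at this
    have hmm : min z (g z) < max z (g z) := min_lt_max.2 (Ne.symm hz)
    obtain ⟨x, hx⟩ := exists_between hmm
    refine ⟨x, equicontinuousAt_of_shrinking (fun k => hg.iterate k)
      (s := uIcc z (g z)) (Icc_mem_nhds hx.1 hx.2) fun ε hε => ?_⟩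
    have hx' : x ∈ uIcc z (g z) := ⟨hx.1.le, hx.2.le⟩
    have hu := hL.uIcc (hL.comp (tendsto_add_atTop_nat 1))
    filter_upwards [tendsto_smallSets_iff.1 hu _ (Metric.ball_mem_nhds L (half_pos hε))]
      with k hk y hy
    have h1 := hk (hsub k x hx')
    have h2 := hk (hsub k y hy)
    rw [Metric.mem_ball] at h1 h2
    calc dist (g^[k] x) (g^[k] y) ≤ dist (g^[k] x) L + dist (g^[k] y) L := dist_triangle_right _ _ _
      _ < ε := by linarith

end Equicontinuity

/-! ### Sensitivity excludes nondegenerate fibres -/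

section Sensitivity

variable {f h : unitInterval → unitInterval} {a : unitInterval}

/-- A periodic tent orbit avoids `1/2`, so each fibre along it stays within one lap. -/
theorem IsTentSemiconj.monotoneOn_or_antitoneOn_iterate (hh : IsTentSemiconj f h a)
    (hf : IsFullUnimodal f a) {s : unitInterval} (hs : s ∈ periodicPts tentMap) (n : ℕ) :
    MonotoneOn f^[n] (h ⁻¹' {s}) ∨ AntitoneOn f^[n] (h ⁻¹' {s}) := by
  induction n with
  | zero => exact Or.inl fun x _ y _ hxy => hxy
  | succ n ih =>
    have hper : tentMap^[n] s ∈ periodicPts tentMap := by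
      obtain ⟨m, hm, hms⟩ := hs
      exact ⟨m, hm, hms.apply_iterate n⟩
    have hmaps := hh.mapsTo_fibre s n
    rw [iterate_succ']
    rcases hh.fibre_subset (coe_ne_half_of_mem_periodicPts_tentMap hper) with hsub | hsub
    · have := hf.strictMonoOn.monotoneOn.mono hsub
      exact ih.imp (fun h => this.comp h hmaps) (fun h => this.comp_AntitoneOn h hmaps)
    · have := hf.strictAntiOn.antitoneOn.mono hsub
      exact ih.symm.imp (fun h => this.comp h hmaps) (fun h => this.comp_MonotoneOn h hmaps)

theorem IsTentSemiconj.exists_equicontinuousAt_of_periodic (hh : IsTentSemiconj f h a)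
    (hf : IsFullUnimodal f a) {s : unitInterval} (hs : s ∈ periodicPts tentMap)
    (hn : (h ⁻¹' {s}).Nontrivial) : ∃ x, EquicontinuousAt (fun n => f^[n]) x := by
  obtain ⟨p, hp, hps⟩ := hs
  have hmaps : MapsTo f^[p] (h ⁻¹' {s}) (h ⁻¹' {s}) := by
    have := hh.mapsTo_fibre s p
    rwa [show tentMap^[p] s = s from hps] at this
  -- Doubling the period makes a possibly decreasing return map increasing.
  have hmono : MonotoneOn f^[p + p] (h ⁻¹' {s}) := by
    rw [iterate_add]
    rcases hh.monotoneOn_or_antitoneOn_iterate hf ⟨p, hp, hps⟩ p with h | h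
    · exact h.comp h hmaps
    · exact h.comp h hmaps
  have hmaps2 : MapsTo f^[p + p] (h ⁻¹' {s}) (h ⁻¹' {s}) := by
    rw [iterate_add]
    exact hmaps.comp hmaps
  obtain ⟨x, hx⟩ := exists_equicontinuousAt_of_monotoneOn (hf.continuous.iterate _)
    (hh.ordConnected_fibre s) hn hmaps2 hmono
  exact ⟨x, equicontinuousAt_iterate_of_power
    (CompactSpace.uniformContinuous_of_continuous hf.continuous) (by omega) hx⟩

theorem IsTentSemiconj.exists_equicontinuousAt_of_injective (hh : IsTentSemiconj f h a)
    (hf : IsFullUnimodal f a) {t : unitInterval} (ht : Injective fun n => tentMap^[n] t)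
    (hn : (h ⁻¹' {t}).Nontrivial) : ∃ x, EquicontinuousAt (fun n => f^[n]) x := by
  obtain ⟨u, v, huv, hsub⟩ := hh.exists_Icc_subset hn
  obtain ⟨x, hx⟩ := exists_between huv
  refine ⟨x, equicontinuousAt_of_shrinking (fun k => hf.continuous.iterate k)
      (s := Icc u v) (Icc_mem_nhds hx.1 hx.2) fun ε hε => ?_⟩
  obtain ⟨C, hC, hmeet⟩ := exists_finite_meets_long_uIcc hε
  -- The tent orbit has no repetitions, so it meets the finite set `h '' C` finitely often; a fibre
  -- missing `C` has diameter at most `ε`.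
  have hfin : {n | tentMap^[n] t ∈ h '' C}.Finite := (hC.image h).preimage ht.injOn
  have hev : ∀ᶠ n in atTop, n ∉ {n | tentMap^[n] t ∈ h '' C} := by
    rw [← Nat.cofinite_eq_atTop]
    exact hfin.eventually_cofinite_notMem
  filter_upwards [hev] with n hn y hy
  by_contra hlt
  obtain ⟨c, hcC, hc⟩ := hmeet _ _ (not_lt.1 hlt)
  refine hn ⟨c, hcC, ?_⟩
  exact (hh.ordConnected_fibre _).uIcc_subset (hh.mapsTo_fibre t n (hsub ⟨hx.1.le, hx.2.le⟩))
    (hh.mapsTo_fibre t n (hsub hy)) hc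

theorem IsTentSemiconj.injective_of_sensitiveDependence (hh : IsTentSemiconj f h a)
    (hf : IsFullUnimodal f a) (hsens : SensitiveDependence f) : Injective h := by
  refine injective_of_forall_not_nontrivial_fibre fun t ht => ?_
  suffices ∃ x, EquicontinuousAt (fun n => f^[n]) x by
    obtain ⟨x, hx⟩ := this
    exact not_sensitiveDependence_of_equicontinuousAt hx hsens
  by_cases hinj : Injective fun n => tentMap^[n] t
  · exact hh.exists_equicontinuousAt_of_injective hf hinj ht
  · obtain ⟨i, j, hij, hlt⟩ : ∃ i j, tentMap^[i] t = tentMap^[j] t ∧ i < j := by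
      simp only [Injective, not_forall] at hinj
      obtain ⟨i, j, hij, hne⟩ := hinj
      rcases Nat.lt_or_gt_of_ne hne with h | h
      · exact ⟨i, j, hij, h⟩
      · exact ⟨j, i, hij.symm, h⟩
    refine hh.exists_equicontinuousAt_of_periodic hf (s := tentMap^[i] t)
      ⟨j - i, by omega, ?_⟩ (hh.nontrivial_fibre_iterate hf ht i)
    rw [IsPeriodicPt, IsFixedPt, ← iterate_add_apply, Nat.sub_add_cancel hlt.le, hij]

theorem IsTentSemiconj.exists_homeomorph (hh : IsTentSemiconj f h a) (hinj : Injective h) :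
    ∃ e : unitInterval ≃ₜ unitInterval, Semiconj e f tentMap :=
  ⟨hh.continuous.homeoOfEquivCompactToT2 (f := Equiv.ofBijective h ⟨hinj, hh.surjective⟩),
    hh.semiconj⟩

end Sensitivity

end

/-! ### The main theorem -/

theorem theorem2 (a : unitInterval) (ha0 : 0 < a) (ha1 : a < 1)
    (f : unitInterval → unitInterval) (hf : Continuous f) (hsurj : Function.Surjective f)
    (hf0 : f 0 = 0) (hf1 : f 1 = 0) (hfa : f a = 1)
    (hmono : StrictMonoOn f (Set.Icc 0 a)) (hanti : StrictAntiOn f (Set.Icc a 1)) :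
    [∃ x, Dense (orbitOf f x),
      Dense (Function.periodicPts f),
      SensitiveDependence f].TFAE ∧
    ((∃ x, Dense (orbitOf f x)) →
      TopologicallyConjugate f tentMap ∧
      ∃ S : Set unitInterval, Dense S ∧ ¬ S.Countable ∧ Set.MapsTo f S S ∧
        IsScrambledSet f 1 S ∧ ∀ x ∈ S, IsTransitivePoint f x) := by
  have hu : IsFullUnimodal f a := ⟨hf, hf0, hf1, hfa, hmono, hanti⟩
  obtain ⟨h, hh⟩ := hu.exists_isTentSemiconj
  have hleo : Function.Injective h → LocallyEventuallyOnto f := fun hinj => by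
    obtain ⟨e, he⟩ := hh.exists_homeomorph hinj
    exact locallyEventuallyOnto_tentMap.of_semiconj e he
  have hscr := fun hinj => (hleo hinj).exists_isScrambledSet hf hsurj hf0 hf1
  refine ⟨?_, fun ⟨x, hx⟩ => ?_⟩
  · tfae_have 1 → 2 := fun ⟨x, hx⟩ =>
      (hleo (hh.injective_of_dense_orbitOf hx)).dense_periodicPts hf
    tfae_have 2 → 3 := fun hd =>
      (hleo (hh.injective_of_dense_periodicPts hu hd)).sensitiveDependence
    tfae_have 3 → 1 := fun hs => by
      obtain ⟨S, hd, -, -, -, htr⟩ := hscr (hh.injective_of_sensitiveDependence hu hs)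
      obtain ⟨x, hx⟩ := hd.nonempty
      exact ⟨x, htr x hx⟩
    tfae_finish
  · have hinj := hh.injective_of_dense_orbitOf hx
    exact ⟨hh.exists_homeomorph hinj, hscr hinj⟩
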